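/- For words $y$ and $n\ge 0$ let $y^n$ be the concatenation of $n$ copies of $y$; a finite word $y$ occurs with \emph{unbounded exponent} in an infinite word ${\bf x}$ if $y^n$ is a factor of ${\bf x}$ for arbitrarily large $n$. For $k\ge 2$, a sequence ${\bf x}=(x_n)_{n\ge 0}$ is \emph{$k$-automatic} if there is a finite automaton with output ($k$-DFAO) which, for every $n\ge 0$, outputs $x_n$ after reading the base-$k$ representation of $n$. Theorem. Let $k\ge 2$ be an integer and let ${\bf x}$ be a $k$-automatic sequence. Then there is a computable bound $B=B({\bf x})$, depending only on ${\bf x}$, such that for every finite word $y$: if $y^B$ occurs as a factor of ${\bf x}$, then $y$ occurs with unbounded exponent in ${\bf x}$. Here "computable" means that there is a single algorithm which, given any $k\ge 2$ and any $k$-DFAO generating a sequence ${\bf x}$, outputs $B({\bf x})$. -/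

import Mathlib

/-- The canonical base-`k` representation of `n` (no leading zeros, so `0` is represented by the
empty word), most significant digit first, as a word over the digit alphabet `{0, …, k-1}`. -/
def baseRep (k : ℕ) (hk : 2 ≤ k) (n : ℕ) : List (Fin k) :=
  ((Nat.digits k n).pmap (fun d h => (⟨d, h⟩ : Fin k))
    (fun _ hd => Nat.digits_lt_base hk hd)).reverse

/-- A deterministic automaton with output whose input alphabet is `{0, …, k-1}`, whose set of
states is `σ`, and whose output alphabet is `α`. -/
structure DFAO (k : ℕ) (σ α : Type*) where
  /-- the transition function -/
  step : σ → Fin k → σ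
  /-- the initial state -/
  start : σ
  /-- the output map -/
  output : σ → α

namespace DFAO

/-- The infinite word generated by `M`: its `n`-th letter is the output of the state that `M`
reaches on reading the base-`k` representation of `n`. -/
def seq {k : ℕ} {σ α : Type*} (M : DFAO k σ α) (hk : 2 ≤ k) (n : ℕ) : α :=
  M.output ((baseRep k hk n).foldl M.step M.start)

/-- The finite description of a DFAO with states `0, …, m-1`: the base `k`, the initial state,
and for every state `q` the output letter of `q` with the list of its successors
on the digits `0, …, k-1`. -/
def code {k m : ℕ} {α : Type*} (M : DFAO k (Fin m) α) : ℕ × ℕ × List (α × List ℕ) :=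
  (k, (M.start : ℕ),
    List.ofFn fun q => (M.output q, List.ofFn fun d => (M.step q d : ℕ)))

end DFAO

/-- `x` is `k`-automatic: it is generated by a DFAO with finitely many states. -/
def IsAutomatic {α : Type*} (k : ℕ) (hk : 2 ≤ k) (x : ℕ → α) : Prop :=
  ∃ (σ : Type) (_ : Finite σ) (M : DFAO k σ α), x = M.seq hk

/-- The finite word `y` is a factor of the infinite word `x`, i.e. `y = x[i..i+|y|-1]`
for some `i`. -/
def IsFactor {α : Type*} (y : List α) (x : ℕ → α) : Prop :=
  ∃ i : ℕ, y = List.ofFn fun j : Fin y.length => x (i + j)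

/-- The power `y ^ n` of a finite word: the concatenation of `n` copies of `y`. -/
def wordPow {α : Type*} (y : List α) (n : ℕ) : List α :=
  (List.replicate n y).flatten

/-- `y` occurs with unbounded exponent in `x`: arbitrarily large powers of `y` are factors
of `x`. -/
def UnboundedExponent {α : Type*} (y : List α) (x : ℕ → α) : Prop :=
  ∀ n : ℕ, ∃ m ≥ n, IsFactor (wordPow y m) x

/-- `B` is computable on automatic sequences: there is an algorithm that, given (the code of) an
arbitrary `k`-DFAO generating a sequence `x`, for an arbitrary `k ≥ 2`, outputs `B x`. Since the
value is `B x`, it depends on `x` alone and not on the automaton that presents `x`. -/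
def ComputableOnAutomatic {α : Type*} [Primcodable α] (B : (ℕ → α) → ℕ) : Prop :=
  ∃ A : ℕ × ℕ × List (α × List ℕ) → ℕ, Computable A ∧
    ∀ (k : ℕ) (hk : 2 ≤ k) (m : ℕ) (M : DFAO k (Fin m) α), A M.code = B (M.seq hk)

/-! The statement "some power of length `L` of the factor of length `p` at position `i` occurs in
`x`" is built from equality of letters, order and linear forms by Boolean operations and
quantifiers. A finite automaton therefore recognizes it on the digits of `(i, p, L)`, with a number
of states bounded in terms of the DFAO and not of `p`.

This allows pumping (`Recognizable.exists_ge`). If `L` has many more digits than `i` and `p`, then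
`L` can be made arbitrarily large with `i` and `p` fixed. Pumping also shows that the first
occurrence of a word of length `p` has only boundedly many more digits than `p`
(`DigitRecursive.firstOccurrence_lt`). Taking `i` to be that first occurrence, a sufficiently large
exponent `L / p`, independent of `p`, forces unbounded exponent
(`DigitRecursive.exists_powerAt_ge`).

That exponent depends on the automaton, whereas the required bound must depend on `x` alone. Hence
`exponentThreshold` is defined intrinsically. Pumping down (`Recognizable.exists_small`) shows that
every exponent contributing to it has a witness of bounded size, so a finite search computes it. -/

/-! ### Recognizable relations: closure properties and pumping -/

/-- A relation on `ℕ^ι` is recognizable with bound `N` if it belongs to a family of at most `N`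
relations that is closed under fixing the least significant base-`k` digits of the arguments. -/
def Recognizable {ι : Type} (k N : ℕ) (R : (ι → ℕ) → Prop) : Prop :=
  ∃ (S : Type) (_ : Fintype S) (F : S → (ι → ℕ) → Prop), Fintype.card S ≤ N ∧ (∃ s, F s = R) ∧
    ∀ s (r : ι → ℕ), (∀ i, r i < k) → ∃ s', ∀ v, F s (fun i => k * v i + r i) ↔ F s' v

namespace Recognizable

theorem congr {ι : Type} {k N : ℕ} {R R' : (ι → ℕ) → Prop} (h : Recognizable k N R)
    (hR : ∀ v, R' v ↔ R v) : Recognizable k N R' := by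
  rwa [show R' = R from funext fun v => propext (hR v)]

theorem not {ι : Type} {k N : ℕ} {R : (ι → ℕ) → Prop} (h : Recognizable k N R) :
    Recognizable k N (fun v => ¬ R v) := by
  obtain ⟨S, _, F, hS, ⟨s, rfl⟩, h⟩ := h
  refine ⟨S, _, fun s v => ¬ F s v, hS, ⟨s, rfl⟩, fun s r hr => ?_⟩
  obtain ⟨s', hs'⟩ := h s r hr
  exact ⟨s', fun v => not_congr (hs' v)⟩

theorem and {ι : Type} {k N₁ N₂ : ℕ} {R₁ R₂ : (ι → ℕ) → Prop} (h₁ : Recognizable k N₁ R₁)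
    (h₂ : Recognizable k N₂ R₂) : Recognizable k (N₁ * N₂) (fun v => R₁ v ∧ R₂ v) := by
  obtain ⟨S₁, _, F₁, hS₁, ⟨s₁, rfl⟩, h₁⟩ := h₁
  obtain ⟨S₂, _, F₂, hS₂, ⟨s₂, rfl⟩, h₂⟩ := h₂
  refine ⟨S₁ × S₂, inferInstance, fun s v => F₁ s.1 v ∧ F₂ s.2 v, ?_, ⟨(s₁, s₂), rfl⟩,
    fun s r hr => ?_⟩
  · rw [Fintype.card_prod]
    exact Nat.mul_le_mul hS₁ hS₂
  · obtain ⟨s₁', hs₁'⟩ := h₁ s.1 r hr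
    obtain ⟨s₂', hs₂'⟩ := h₂ s.2 r hr
    exact ⟨(s₁', s₂'), fun v => and_congr (hs₁' v) (hs₂' v)⟩

/-- Subset construction: the low digit of the quantified variable is guessed, and the set of all
resulting states is kept. The relations live on numbers rather than digit strings, so no padding by
leading zeros is needed. -/
theorem exists_cons {d k N : ℕ} (hk : 0 < k) {R : (Fin (d + 1) → ℕ) → Prop}
    (h : Recognizable k N R) :
    Recognizable k (2 ^ N) (fun v : Fin d → ℕ => ∃ u, R (Matrix.vecCons u v)) := by
  classical
  obtain ⟨S, _, F, hS, ⟨s, rfl⟩, h⟩ := h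
  refine ⟨Set S, inferInstance, fun A v => ∃ u, ∃ s ∈ A, F s (Matrix.vecCons u v), ?_, ⟨{s}, ?_⟩,
    fun A r hr => ?_⟩
  · rw [Fintype.card_set]
    exact Nat.pow_le_pow_right two_pos hS
  · simp
  · refine ⟨{s' | ∃ s ∈ A, ∃ c < k, ∀ v, F s (fun i => k * v i + Matrix.vecCons c r i) ↔ F s' v},
      fun v => ⟨?_, ?_⟩⟩
    · rintro ⟨u, s, hs, hF⟩
      have hc : ∀ i, Matrix.vecCons (u % k) r i < k :=
        Fin.cases (Nat.mod_lt _ hk) hr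
      obtain ⟨s', hs'⟩ := h s _ hc
      refine ⟨u / k, s', ⟨s, hs, u % k, Nat.mod_lt _ hk, hs'⟩, (hs' _).1 ?_⟩
      convert hF using 1
      funext i
      refine Fin.cases ?_ (fun i => ?_) i
      · simpa using Nat.div_add_mod u k
      · simp
    · rintro ⟨u, s', ⟨s, hs, c, -, hs'⟩, hF⟩
      refine ⟨k * u + c, s, hs, ?_⟩
      convert (hs' _).2 hF using 1
      funext i
      refine Fin.cases ?_ (fun i => ?_) i <;> simp

/-- Recognizable relations are closed under substitution of linear forms; the extra states keep
track of the carries. -/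
theorem comp_linear {d e k N : ℕ} (hk : 0 < k) {R : (Fin e → ℕ) → Prop}
    (h : Recognizable k N R) (w : ℕ) (a : Fin e → Fin d → ℕ) (ha : ∀ j, ∑ i, a j i ≤ w) :
    Recognizable k (N * (w + 1) ^ e) (fun v => R (fun j => ∑ i, a j i * v i)) := by
  obtain ⟨S, _, F, hS, ⟨s, rfl⟩, h⟩ := h
  refine ⟨S × (Fin e → Fin (w + 1)), inferInstance,
    fun s v => F s.1 (fun j => ∑ i, a j i * v i + s.2 j), ?_, ⟨(s, 0), ?_⟩, fun s r hr => ?_⟩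
  · rw [Fintype.card_prod, Fintype.card_fun, Fintype.card_fin, Fintype.card_fin]
    exact Nat.mul_le_mul_right _ hS
  · simp
  · obtain ⟨s', hs'⟩ := h s.1 (fun j => (∑ i, a j i * r i + s.2 j) % k)
      (fun j => Nat.mod_lt _ hk)
    -- Carries stay at most `w`, because `w * (k - 1) + w = w * k < (w + 1) * k`.
    have hc : ∀ j, (∑ i, a j i * r i + s.2 j) / k < w + 1 := fun j => by
      rw [Nat.div_lt_iff_lt_mul hk]
      have h1 : ∑ i, a j i * r i ≤ w * (k - 1) :=
        calc ∑ i, a j i * r i ≤ ∑ i, a j i * (k - 1) :=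
              Finset.sum_le_sum fun i _ => Nat.mul_le_mul_left _ (Nat.le_sub_one_of_lt (hr i))
          _ = (∑ i, a j i) * (k - 1) := (Finset.sum_mul ..).symm
          _ ≤ w * (k - 1) := Nat.mul_le_mul_right _ (ha j)
      have h2 := (s.2 j).isLt
      obtain ⟨k, rfl⟩ := Nat.exists_eq_succ_of_ne_zero hk.ne'
      simp only [Nat.succ_eq_add_one, Nat.add_sub_cancel] at *
      nlinarith
    refine ⟨(s', fun j => ⟨_, hc j⟩), fun v => ?_⟩
    dsimp only
    rw [← hs']
    refine iff_of_eq (congrArg _ (funext fun j => ?_))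
    have h1 : ∑ i, a j i * (k * v i + r i) = k * ∑ i, a j i * v i + ∑ i, a j i * r i := by
      rw [Finset.mul_sum, ← Finset.sum_add_distrib]
      exact Finset.sum_congr rfl fun i _ => by ring
    have h2 := Nat.div_add_mod (∑ i, a j i * r i + s.2 j) k
    rw [h1, mul_add]
    omega

/-- Two states suffice: after a low digit is fixed, the comparison of the remaining parts is strict
or weak according to how the low digits compare. -/
theorem lt (k : ℕ) : Recognizable k 2 (fun v : Fin 2 → ℕ => v 0 < v 1) := by
  refine ⟨Bool, inferInstance, fun b v => if b then v 0 ≤ v 1 else v 0 < v 1, by simp,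
    ⟨false, by simp⟩, fun b r hr => ?_⟩
  have key : ∀ v : Fin 2 → ℕ, (v 0 < v 1 → k * v 0 + k ≤ k * v 1) ∧
      (v 1 < v 0 → k * v 1 + k ≤ k * v 0) ∧ (v 0 = v 1 → k * v 0 = k * v 1) := fun v =>
    ⟨fun h => by nlinarith, fun h => by nlinarith, fun h => by rw [h]⟩
  have h0 := hr 0
  have h1 := hr 1
  cases b
  · refine ⟨decide (r 0 < r 1), fun v => ?_⟩
    obtain ⟨k1, k2, k3⟩ := key v
    rcases lt_trichotomy (v 0) (v 1) with h | h | h <;> by_cases h' : r 0 < r 1 <;>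
      simp [h'] <;> omega
  · refine ⟨decide (r 0 ≤ r 1), fun v => ?_⟩
    obtain ⟨k1, k2, k3⟩ := key v
    rcases lt_trichotomy (v 0) (v 1) with h | h | h <;> by_cases h' : r 0 ≤ r 1 <;>
      simp [h'] <;> omega

/-- Pigeonhole on the `N + 1` relations left after fixing the lowest `s`, ..., `s + N` digits of
`v`. -/
theorem exists_repeat {ι : Type} {k N : ℕ} {R : (ι → ℕ) → Prop} (hk : 0 < k)
    (h : Recognizable k N R) (v : ι → ℕ) (s : ℕ) :
    ∃ a b, s ≤ a ∧ a < b ∧ b ≤ s + N ∧ ∀ w : ι → ℕ,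
      R (fun i => k ^ a * w i + v i % k ^ a) ↔ R (fun i => k ^ b * w i + v i % k ^ b) := by
  obtain ⟨S, _, F, hS, ⟨s₀, rfl⟩, h⟩ := h
  choose g hg using fun (s : S) (t : ℕ) =>
    h s (fun i => v i / k ^ t % k) (fun i => Nat.mod_lt _ hk)
  let q : ℕ → S := fun t => Nat.rec s₀ (fun t s => g s t) t
  have hq : ∀ t w, F (q t) w ↔ F s₀ (fun i => k ^ t * w i + v i % k ^ t) := by
    intro t
    induction t with
    | zero => intro w; simp [q, Nat.mod_one]
    | succ t ih =>
      intro w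
      change F (g (q t) t) w ↔ _
      rw [← hg, ih]
      refine iff_of_eq (congrArg _ (funext fun i => ?_))
      rw [Nat.mod_pow_succ]
      ring
  obtain ⟨a, b, hab, he⟩ := Fintype.exists_ne_map_eq_of_card_lt
    (fun t : Fin (N + 1) => q (s + t)) (by rw [Fintype.card_fin]; omega)
  have ha := a.isLt
  have hb := b.isLt
  have hab' : (a : ℕ) ≠ b := fun h => hab (Fin.ext h)
  rcases lt_or_gt_of_ne hab' with hlt | hlt
  · exact ⟨s + a, s + b, by omega, by omega, by omega, fun w => by
      rw [← hq, ← hq]; exact iff_of_eq (congrArg (fun s => F s w) he)⟩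
  · exact ⟨s + b, s + a, by omega, by omega, by omega, fun w => by
      rw [← hq, ← hq]; exact iff_of_eq (congrArg (fun s => F s w) he.symm)⟩

/-- Pumping up: the digit block between the positions `a` and `b` of a repeated state is duplicated.
Coordinates below `k ^ s` have only zeros there and above, so they do not change. -/
theorem exists_gt {ι : Type} {k N : ℕ} {R : (ι → ℕ) → Prop} (hk : 2 ≤ k)
    (h : Recognizable k N R) {v : ι → ℕ} (hv : R v) (s : ℕ) {i₀ : ι}
    (hi : k ^ (s + N) ≤ v i₀) :
    ∃ v', R v' ∧ (∀ i, v i < k ^ s → v' i = v i) ∧ v i₀ < v' i₀ := by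
  obtain ⟨a, b, hsa, hab, hb, hR⟩ := h.exists_repeat (by omega) v s
  refine ⟨fun i => k ^ b * (v i / k ^ a) + v i % k ^ b, ?_, fun i hi => ?_, ?_⟩
  · rw [← hR]
    simpa only [Nat.div_add_mod] using hv
  · have h1 : v i < k ^ a := hi.trans_le (Nat.pow_le_pow_right (by omega) hsa)
    have h2 : v i < k ^ b := h1.trans (Nat.pow_lt_pow_right (by omega) hab)
    simp [Nat.div_eq_of_lt h1, Nat.mod_eq_of_lt h2]
  · have h0 : 0 < k ^ a := Nat.pow_pos (by omega)
    have h1 : k ^ a ≤ v i₀ := (Nat.pow_le_pow_right (by omega) (by omega)).trans hi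
    have h2 : 0 < v i₀ / k ^ a := Nat.div_pos h1 h0
    have h3 : 2 * k ^ a ≤ k ^ b :=
      calc 2 * k ^ a ≤ k * k ^ a := Nat.mul_le_mul_right _ hk
        _ = k ^ (a + 1) := by rw [pow_succ, mul_comm]
        _ ≤ k ^ b := Nat.pow_le_pow_right (by omega) hab
    have h4 := Nat.div_add_mod (v i₀) (k ^ a)
    have h5 := Nat.mod_lt (v i₀) h0
    have h6 : 2 * k ^ a * (v i₀ / k ^ a) ≤ k ^ b * (v i₀ / k ^ a) := Nat.mul_le_mul_right _ h3
    have h7 : k ^ a * 1 ≤ k ^ a * (v i₀ / k ^ a) := Nat.mul_le_mul_left _ h2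
    rw [mul_assoc] at h6
    linarith [Nat.zero_le (v i₀ % k ^ b)]

theorem exists_ge {ι : Type} {k N : ℕ} {R : (ι → ℕ) → Prop} (hk : 2 ≤ k)
    (h : Recognizable k N R) {v : ι → ℕ} (hv : R v) (s : ℕ) {i₀ : ι}
    (hi : k ^ (s + N) ≤ v i₀) (L : ℕ) :
    ∃ v', R v' ∧ (∀ i, v i < k ^ s → v' i = v i) ∧ v i₀ ≤ v' i₀ ∧ L ≤ v' i₀ := by
  induction L with
  | zero => exact ⟨v, hv, fun _ _ => rfl, le_rfl, Nat.zero_le _⟩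
  | succ L ih =>
    obtain ⟨v', hv', h1, h2, h3⟩ := ih
    obtain ⟨v'', hv'', h4, h5⟩ := h.exists_gt hk hv' s (hi.trans h2)
    exact ⟨v'', hv'', fun i hi => by rw [h4 i (by rwa [h1 i hi]), h1 i hi], by omega, by omega⟩

/-- Pumping down: as long as some coordinate is large, deleting the block between two equal states
decreases the sum of the coordinates. -/
theorem exists_small {ι : Type} [Fintype ι] {k N : ℕ} {R : (ι → ℕ) → Prop} (hk : 2 ≤ k)
    (h : Recognizable k N R) {v : ι → ℕ} (hv : R v) (s : ℕ) :
    ∃ v', R v' ∧ (∀ i, v i < k ^ s → v' i = v i) ∧ ∀ i, v' i < k ^ (s + N) := by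
  induction hn : ∑ i, v i using Nat.strong_induction_on generalizing v with
  | _ n ih =>
  by_cases hsmall : ∀ i, v i < k ^ (s + N)
  · exact ⟨v, hv, fun _ _ => rfl, hsmall⟩
  push Not at hsmall
  obtain ⟨i₀, hi₀⟩ := hsmall
  obtain ⟨a, b, hsa, hab, hb, hR⟩ := h.exists_repeat (by omega) v s
  let v' : ι → ℕ := fun i => k ^ a * (v i / k ^ b) + v i % k ^ a
  have hpow : k ^ a < k ^ b := Nat.pow_lt_pow_right (by omega) hab
  have h0 : 0 < k ^ a := Nat.pow_pos (by omega)
  have hv' : R v' := by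
    rw [hR]
    simpa only [Nat.div_add_mod] using hv
  have hagree : ∀ i, v i < k ^ s → v' i = v i := fun i hi => by
    have h1 : v i < k ^ a := hi.trans_le (Nat.pow_le_pow_right (by omega) hsa)
    simp [v', Nat.div_eq_of_lt (h1.trans hpow), Nat.mod_eq_of_lt h1]
  have hle : ∀ i, v' i ≤ v i := fun i => by
    calc v' i ≤ k ^ a * (v i / k ^ a) + v i % k ^ a := 
          Nat.add_le_add_right (Nat.mul_le_mul_left _ (Nat.div_le_div_left hpow.le h0)) _
      _ = v i := Nat.div_add_mod _ _
  have hlt : v' i₀ < v i₀ := by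
    have h1 : 0 < v i₀ / k ^ b :=
      Nat.div_pos ((Nat.pow_le_pow_right (by omega) hb).trans hi₀) (h0.trans hpow)
    calc v' i₀ < k ^ b * (v i₀ / k ^ b) + v i₀ % k ^ b := by
          refine add_lt_add_of_lt_of_le (Nat.mul_lt_mul_of_pos_right hpow h1) ?_
          rw [← Nat.mod_mod_of_dvd (v i₀) (pow_dvd_pow k hab.le)]
          exact Nat.mod_le _ _
      _ = v i₀ := Nat.div_add_mod _ _
  obtain ⟨v'', hv'', h1, h2⟩ := ih _ (hn ▸ Finset.sum_lt_sum (fun i _ => hle i)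
    ⟨i₀, Finset.mem_univ _, hlt⟩) hv' rfl
  exact ⟨v'', hv'', fun i hi => by rw [h1 i (by rwa [hagree i hi]), hagree i hi], h2⟩

end Recognizable

/-! ### Recognizable relations between factors of an automatic sequence -/

/-- `x n` is the output of a state, one of at most `M`, that is computed from the base-`k` digits
of `n`, and not affected by leading zeros. -/
def DigitRecursive {α : Type*} (k M : ℕ) (x : ℕ → α) : Prop :=
  ∃ (σ : Type) (_ : Fintype σ) (Q : ℕ → σ) (δ : σ → ℕ → σ) (out : σ → α),
    Fintype.card σ ≤ M ∧ (∀ n d, d < k → Q (k * n + d) = δ (Q n) d) ∧ ∀ n, x n = out (Q n)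

/-- The factors of length `p` of `x` at the positions `i` and `j` are equal. -/
def Agree {α : Type*} (x : ℕ → α) (i j p : ℕ) : Prop :=
  ∀ u < p, x (i + u) = x (j + u)

/-- The factor of `x` of length `L` at position `j` has period `p`. -/
def HasPeriodAt {α : Type*} (x : ℕ → α) (p j L : ℕ) : Prop :=
  ∀ u, u + p < L → x (j + u) = x (j + u + p)

/-- The factor of length `L` at position `j` is a fractional power of the factor of length `p` at
position `i`. -/
def PowerAt {α : Type*} (x : ℕ → α) (j i p L : ℕ) : Prop :=
  Agree x i j p ∧ HasPeriodAt x p j L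

/-- The factor of `x` of length `p` at position `i` does not occur earlier. -/
def FirstOccurrence {α : Type*} (x : ℕ → α) (i p : ℕ) : Prop :=
  ¬ ∃ i', i' < i ∧ Agree x i' i p

/-- The remainder `u % p` is not a linear form; agreement on one period together with periodicity
replaces it by conditions on linear forms. -/
theorem powerAt_iff {α : Type*} {x : ℕ → α} {j i p L : ℕ} (hp : 0 < p) (hL : p ≤ L) :
    PowerAt x j i p L ↔ ∀ u < L, x (j + u) = x (i + u % p) := by
  constructor
  · rintro ⟨h1, h2⟩ u
    induction u using Nat.strong_induction_on with
    | _ u ih =>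
    intro hu
    rcases lt_or_ge u p with h | h
    · rw [Nat.mod_eq_of_lt h, h1 u h]
    · obtain ⟨t, rfl⟩ := Nat.exists_eq_add_of_le' h
      rw [← add_assoc, ← h2 t hu, Nat.add_mod_right]
      exact ih t (by omega) (by omega)
  · intro h
    refine ⟨fun u hu => ?_, fun u hu => ?_⟩
    · rw [h u (hu.trans_le hL), Nat.mod_eq_of_lt hu]
    · rw [add_assoc, h _ hu, h u (by omega), Nat.add_mod_right]

/-- A bound for the relation `x i = x j`. -/
def eqBound (M : ℕ) : ℕ := M ^ M * M ^ M

/-- A bound for `Agree`. -/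
def agreeBound (M : ℕ) : ℕ := 2 ^ (8 * (eqBound M * 9))

/-- A bound for `HasPeriodAt`. -/
def periodBound (M : ℕ) : ℕ := 2 ^ (18 * (eqBound M * 16))

/-- A bound for `PowerAt`. -/
def powerBound (M : ℕ) : ℕ := agreeBound M * 2 ^ 3 * (periodBound M * 2 ^ 3)

/-- A bound for `FirstOccurrence`. -/
def firstBound (M : ℕ) : ℕ := 2 ^ (8 * (agreeBound M * 2 ^ 3))

section

variable {α : Type*} {k M : ℕ} {x : ℕ → α}

/-- Digits are removed from the low end while `δ` reads from the high end. A state therefore stores,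
for each argument, the map on `σ` induced by the digits already removed. -/
theorem DigitRecursive.recognizable_eq (hx : DigitRecursive k M x) :
    Recognizable k (eqBound M) (fun v : Fin 2 → ℕ => x (v 0) = x (v 1)) := by
  classical
  obtain ⟨σ, _, Q, δ, out, hM, hQ, hx⟩ := hx
  have hc : Fintype.card (σ → σ) ≤ M ^ M := by
    have h0 : 0 < Fintype.card σ := Fintype.card_pos_iff.2 ⟨Q 0⟩
    rw [Fintype.card_fun]
    exact (Nat.pow_le_pow_left hM _).trans (Nat.pow_le_pow_right (h0.trans_le hM) hM)
  refine ⟨(σ → σ) × (σ → σ), inferInstance,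
    fun s v => out (s.1 (Q (v 0))) = out (s.2 (Q (v 1))), ?_, ⟨(id, id), ?_⟩, fun s r hr => ?_⟩
  · rw [Fintype.card_prod]
    exact Nat.mul_le_mul hc hc
  · simp [hx]
  · refine ⟨(fun q => s.1 (δ q (r 0)), fun q => s.2 (δ q (r 1))), fun v => ?_⟩
    dsimp only
    rw [hQ _ _ (hr 0), hQ _ _ (hr 1)]

theorem DigitRecursive.recognizable_agree (hk : 0 < k) (hx : DigitRecursive k M x) :
    Recognizable k (agreeBound M) (fun v : Fin 3 → ℕ => Agree x (v 0) (v 1) (v 2)) := by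
  -- The rows are linear forms in `(u, i, j, p)`, with the quantified variable first; "for all `u`"
  -- is expressed as "no counterexample".
  have h1 := hx.recognizable_eq.comp_linear (d := 4) hk 2 ![![1, 1, 0, 0], ![1, 0, 1, 0]]
    (by intro j; fin_cases j <;> simp [Fin.sum_univ_four])
  have h2 := (Recognizable.lt k).comp_linear (d := 4) hk 1 ![![1, 0, 0, 0], ![0, 0, 0, 1]]
    (by intro j; fin_cases j <;> simp [Fin.sum_univ_four])
  refine (h2.and h1.not).exists_cons hk |>.not.congr fun v => ?_
  simp [Fin.sum_univ_four, Agree, add_comm]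

theorem DigitRecursive.recognizable_hasPeriodAt (hk : 0 < k) (hx : DigitRecursive k M x) :
    Recognizable k (periodBound M)
      (fun v : Fin 3 → ℕ => HasPeriodAt x (v 0) (v 1) (v 2)) := by
  have h1 := hx.recognizable_eq.comp_linear (d := 4) hk 3 ![![1, 0, 1, 0], ![1, 1, 1, 0]]
    (by intro j; fin_cases j <;> simp [Fin.sum_univ_four])
  have h2 := (Recognizable.lt k).comp_linear (d := 4) hk 2 ![![1, 1, 0, 0], ![0, 0, 0, 1]]
    (by intro j; fin_cases j <;> simp [Fin.sum_univ_four])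
  refine (h2.and h1.not).exists_cons hk |>.not.congr fun v => ?_
  simp [Fin.sum_univ_four, HasPeriodAt, add_comm, add_left_comm, add_assoc]

theorem DigitRecursive.recognizable_powerAt (hk : 0 < k) (hx : DigitRecursive k M x) :
    Recognizable k (powerBound M)
      (fun v : Fin 4 → ℕ => PowerAt x (v 0) (v 1) (v 2) (v 3)) := by
  have h1 := (hx.recognizable_agree hk).comp_linear (d := 4) hk 1
    ![![0, 1, 0, 0], ![1, 0, 0, 0], ![0, 0, 1, 0]]
    (by intro j; fin_cases j <;> simp [Fin.sum_univ_four])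
  have h2 := (hx.recognizable_hasPeriodAt hk).comp_linear (d := 4) hk 1
    ![![0, 0, 1, 0], ![1, 0, 0, 0], ![0, 0, 0, 1]]
    (by intro j; fin_cases j <;> simp [Fin.sum_univ_four])
  refine (h1.and h2).congr fun v => ?_
  simp [Fin.sum_univ_four, PowerAt]

theorem DigitRecursive.recognizable_exists_powerAt (hk : 0 < k) (hx : DigitRecursive k M x) :
    Recognizable k (2 ^ powerBound M)
      (fun v : Fin 3 → ℕ => ∃ j, PowerAt x j (v 0) (v 1) (v 2)) :=
  ((hx.recognizable_powerAt hk).exists_cons hk).congr fun v => by simp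

theorem DigitRecursive.recognizable_powerAt_mul (hk : 0 < k) (hx : DigitRecursive k M x)
    {n b : ℕ} (hn : n ≤ b) :
    Recognizable k (powerBound M * (b + 2) ^ 4)
      (fun v : Fin 3 → ℕ => PowerAt x (v 0) (v 1) (v 2) (n * v 2)) := by
  -- The weight is `b + 1` so that it also covers the rows of sum 1 when `b = 0`.
  have h := (hx.recognizable_powerAt hk).comp_linear (d := 3) hk (b + 1)
    ![![1, 0, 0], ![0, 1, 0], ![0, 0, 1], ![0, 0, n]]
    (by intro j; fin_cases j <;> simp [Fin.sum_univ_three]; omega)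
  exact h.congr fun v => by simp [Fin.sum_univ_three]

theorem DigitRecursive.recognizable_exists_powerAt_mul (hk : 0 < k) (hx : DigitRecursive k M x)
    {n b : ℕ} (hn : n ≤ b) :
    Recognizable k (2 ^ powerBound M * (b + 2) ^ 3)
      (fun v : Fin 2 → ℕ => ∃ j, PowerAt x j (v 0) (v 1) (n * v 1)) := by
  have h := (hx.recognizable_exists_powerAt hk).comp_linear (d := 2) hk (b + 1)
    ![![1, 0], ![0, 1], ![0, n]]
    (by intro j; fin_cases j <;> simp [Fin.sum_univ_two]; omega)
  exact h.congr fun v => by simp [Fin.sum_univ_two]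

theorem DigitRecursive.recognizable_firstOccurrence (hk : 0 < k) (hx : DigitRecursive k M x) :
    Recognizable k (firstBound M) (fun v : Fin 2 → ℕ => FirstOccurrence x (v 0) (v 1)) := by
  have h1 := (hx.recognizable_agree hk).comp_linear (d := 3) hk 1
    ![![1, 0, 0], ![0, 1, 0], ![0, 0, 1]]
    (by intro j; fin_cases j <;> simp [Fin.sum_univ_three])
  have h2 := (Recognizable.lt k).comp_linear (d := 3) hk 1 ![![1, 0, 0], ![0, 1, 0]]
    (by intro j; fin_cases j <;> simp [Fin.sum_univ_three])
  refine (h2.and h1).exists_cons hk |>.not.congr fun v => ?_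
  simp [Fin.sum_univ_three, FirstOccurrence]

theorem DigitRecursive.finite_range (hx : DigitRecursive k M x) : (Set.range x).Finite := by
  obtain ⟨σ, _, Q, δ, out, -, -, hx⟩ := hx
  exact (Set.finite_range out).subset (by rintro _ ⟨n, rfl⟩; exact ⟨Q n, (hx n).symm⟩)

/-- Finitely many words of length `p` occur in `x`, so their first occurrences are bounded. -/
theorem DigitRecursive.exists_firstOccurrence_bound (hx : DigitRecursive k M x) (p : ℕ) :
    ∃ C, ∀ i, FirstOccurrence x i p → i < C := by
  have hfin := hx.finite_range.to_subtype
  let f : ℕ → Fin p → Set.range x := fun i u => ⟨x (i + u), _, rfl⟩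
  have hinj : Set.InjOn f {i | FirstOccurrence x i p} := by
    have key : ∀ i i', f i = f i' → Agree x i i' p := fun i i' h u hu =>
      congrArg Subtype.val (congrFun h ⟨u, hu⟩)
    intro i hi i' hi' h
    rcases lt_trichotomy i i' with hlt | heq | hlt
    · exact (hi' ⟨i, hlt, key _ _ h⟩).elim
    · exact heq
    · exact (hi ⟨i', hlt, key _ _ h.symm⟩).elim
  obtain ⟨C, hC⟩ := (Set.Finite.of_finite_image (Set.toFinite _) hinj).bddAbove
  exact ⟨C + 1, fun i hi => Nat.lt_succ_of_le (hC hi)⟩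

/-- Otherwise pumping `i` with `p` fixed would give arbitrarily late first occurrences of words of
length `p`, but there are only finitely many such words. -/
theorem DigitRecursive.firstOccurrence_lt (hk : 2 ≤ k) (hx : DigitRecursive k M x) {i p s : ℕ}
    (hp : p < k ^ s) (hi : FirstOccurrence x i p) : i < k ^ (s + firstBound M) := by
  by_contra! hlt
  obtain ⟨C, hC⟩ := hx.exists_firstOccurrence_bound p
  obtain ⟨v, hv, h1, -, h2⟩ := (hx.recognizable_firstOccurrence (by omega)).exists_ge hk
    (v := ![i, p]) hi s (i₀ := 0) hlt C
  have h3 : v 1 = p := h1 1 hp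
  rw [h3] at hv
  exact absurd (hC _ hv) (by omega)

theorem exists_firstOccurrence_agree (x : ℕ → α) (i p : ℕ) :
    ∃ i', FirstOccurrence x i' p ∧ Agree x i' i p := by
  classical
  have h : ∃ i', Agree x i' i p := ⟨i, fun _ _ => rfl⟩
  refine ⟨Nat.find h, ?_, Nat.find_spec h⟩
  rintro ⟨i', h1, h2⟩
  exact Nat.find_min h h1 fun u hu => (h2 u hu).trans (Nat.find_spec h u hu)

/-! ### A uniform exponent that forces unbounded exponent -/

/-- An exponent from which on powers extend to arbitrarily large powers. -/
def exponentBound (k M : ℕ) : ℕ := k ^ (2 ^ powerBound M + firstBound M + 1)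

theorem DigitRecursive.exists_powerAt_ge (hk : 2 ≤ k) (hx : DigitRecursive k M x) {j i p : ℕ}
    (hp : 0 < p) (h : PowerAt x j i p (exponentBound k M * p)) (n : ℕ) :
    ∃ j' L, n ≤ L ∧ PowerAt x j' i p L := by
  -- The given `i` may be far larger than `p`; the first occurrence is not, so pumping the length
  -- leaves it fixed.
  obtain ⟨i', hi', hag⟩ := exists_firstOccurrence_agree x i p
  set s := Nat.log k p + 1 with hs
  have hps : p < k ^ s := Nat.lt_pow_succ_log_self (by omega) p
  -- This loss of a factor `k` accounts for the `+ 1` in `exponentBound`.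
  have hsp : k ^ s ≤ k * p := by
    rw [hs, pow_succ, mul_comm]
    exact Nat.mul_le_mul_left _ (Nat.pow_log_le_self k hp.ne')
  have hlt := hx.firstOccurrence_lt hk hps hi'
  have h' : PowerAt x j i' p (exponentBound k M * p) :=
    ⟨fun u hu => (hag u hu).trans (h.1 u hu), h.2⟩
  obtain ⟨v, ⟨j', hv⟩, h1, -, h2⟩ := (hx.recognizable_exists_powerAt (by omega)).exists_ge hk
    (v := ![i', p, exponentBound k M * p]) ⟨j, h'⟩ (s + firstBound M) (i₀ := 2) (by
      change _ ≤ k ^ (2 ^ powerBound M + firstBound M + 1) * p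
      calc k ^ (s + firstBound M + 2 ^ powerBound M)
          = k ^ (2 ^ powerBound M + firstBound M) * k ^ s := by rw [← pow_add]; congr 1; omega
        _ ≤ k ^ (2 ^ powerBound M + firstBound M) * (k * p) := Nat.mul_le_mul_left _ hsp
        _ = k ^ (2 ^ powerBound M + firstBound M + 1) * p := by rw [pow_succ, mul_assoc]) n
  have h3 : v 0 = i' := h1 0 hlt
  have h4 : v 1 = p := h1 1 (hps.trans_le (Nat.pow_le_pow_right (by omega) (by omega)))
  rw [h3, h4] at hv
  exact ⟨j', v 2, h2, fun u hu => (hag u hu).symm.trans (hv.1 u hu), hv.2⟩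

/-! ### Small witnesses for the search -/

/-- Digits needed to search for words with a power but without a larger one. -/
def wordDigits (k M : ℕ) : ℕ :=
  2 ^ powerBound M * (exponentBound k M + 2) ^ 3 *
    (2 ^ powerBound M * (exponentBound k M + 2) ^ 3)

/-- Digits needed to search for occurrences of powers of such words. -/
def positionDigits (k M : ℕ) : ℕ :=
  wordDigits k M + powerBound M * (exponentBound k M + 2) ^ 4

theorem DigitRecursive.exists_small_word (hk : 2 ≤ k) (hx : DigitRecursive k M x) {n i p : ℕ}
    (hn : n ≤ exponentBound k M) (h1 : ∃ j, PowerAt x j i p (n * p))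
    (h2 : ¬ ∃ j, PowerAt x j i p (exponentBound k M * p)) :
    ∃ i < k ^ wordDigits k M, ∃ p < k ^ wordDigits k M, (∃ j, PowerAt x j i p (n * p)) ∧
      ¬ ∃ j, PowerAt x j i p (exponentBound k M * p) := by
  obtain ⟨v, hv, -, hlt⟩ := ((hx.recognizable_exists_powerAt_mul (by omega) hn).and
    (hx.recognizable_exists_powerAt_mul (by omega) le_rfl).not).exists_small hk
    (v := ![i, p]) ⟨h1, h2⟩ 0
  rw [zero_add] at hlt
  exact ⟨v 0, hlt 0, v 1, hlt 1, hv⟩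

/-- Pumping down starts above the digits of `i` and `p`, so the word is kept and only its position
shrinks. -/
theorem DigitRecursive.exists_small_position (hk : 2 ≤ k) (hx : DigitRecursive k M x)
    {n i p : ℕ} (hn : n ≤ exponentBound k M) (hi : i < k ^ wordDigits k M)
    (hp : p < k ^ wordDigits k M) (h : ∃ j, PowerAt x j i p (n * p)) :
    ∃ j < k ^ positionDigits k M, PowerAt x j i p (n * p) := by
  obtain ⟨j, hj⟩ := h
  obtain ⟨v, hv, hag, hlt⟩ := (hx.recognizable_powerAt_mul (by omega) hn).exists_small hk
    (v := ![j, i, p]) hj (wordDigits k M)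
  have h1 : v 1 = i := hag 1 hi
  have h2 : v 2 = p := hag 2 hp
  rw [h1, h2] at hv
  exact ⟨v 0, hlt 0, hv⟩

end

/-! ### Powers of words and their positions -/

theorem getElem?_wordPow {α : Type*} (y : List α) (n u : ℕ) (hu : u < n * y.length) :
    (wordPow y n)[u]? = y[u % y.length]? := by
  induction n generalizing u with
  | zero => omega
  | succ n ih =>
    rw [wordPow, List.replicate_succ, List.flatten_cons]
    rcases lt_or_ge u y.length with h | h
    · rw [List.getElem?_append_left h, Nat.mod_eq_of_lt h]
    · obtain ⟨t, rfl⟩ := Nat.exists_eq_add_of_le' h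
      rw [List.getElem?_append_right h, Nat.add_sub_cancel, Nat.add_mod_right]
      exact ih t (by rw [add_mul, one_mul] at hu; omega)

theorem length_wordPow {α : Type*} (y : List α) (n : ℕ) :
    (wordPow y n).length = n * y.length := by
  simp [wordPow]

theorem isFactor_iff {α : Type*} {y : List α} {x : ℕ → α} :
    IsFactor y x ↔ ∃ i, ∀ u < y.length, y[u]? = some (x (i + u)) := by
  refine exists_congr fun i => ⟨fun h u hu => ?_, fun h => ?_⟩
  · rw [h]
    simp [hu]
  · refine List.ext_getElem? fun u => ?_
    rcases lt_or_ge u y.length with hu | hu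
    · rw [h u hu]
      simp [hu]
    · simp [hu]

theorem isFactor_wordPow_iff {α : Type*} {y : List α} {x : ℕ → α} {n : ℕ} :
    IsFactor (wordPow y n) x ↔
      ∃ j, ∀ u < n * y.length, y[u % y.length]? = some (x (j + u)) := by
  rw [isFactor_iff, length_wordPow]
  exact exists_congr fun j => forall₂_congr fun u hu => by rw [getElem?_wordPow y n u hu]

theorem IsFactor.wordPow_mono {α : Type*} {y : List α} {x : ℕ → α} {m n : ℕ} (hmn : m ≤ n)
    (h : IsFactor (wordPow y n) x) : IsFactor (wordPow y m) x := by
  rw [isFactor_wordPow_iff] at h ⊢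
  obtain ⟨j, hj⟩ := h
  exact ⟨j, fun u hu => hj u (hu.trans_le (Nat.mul_le_mul_right _ hmn))⟩

theorem IsFactor.of_wordPow {α : Type*} {y : List α} {x : ℕ → α} {n : ℕ} (hn : 0 < n)
    (h : IsFactor (wordPow y n) x) : IsFactor y x := by
  have h1 : IsFactor (wordPow y 1) x := h.wordPow_mono hn
  simpa [wordPow] using h1

theorem isFactor_wordPow_iff_powerAt {α : Type*} {y : List α} {x : ℕ → α} {n i : ℕ}
    (hy : 0 < y.length) (hi : ∀ u < y.length, y[u]? = some (x (i + u))) (hn : 0 < n) :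
    IsFactor (wordPow y n) x ↔ ∃ j, PowerAt x j i y.length (n * y.length) := by
  rw [isFactor_wordPow_iff]
  refine exists_congr fun j => ?_
  rw [powerAt_iff hy (Nat.le_mul_of_pos_left _ hn)]
  refine forall₂_congr fun u _ => ?_
  rw [hi _ (Nat.mod_lt _ hy), Option.some_inj, eq_comm]

theorem unboundedExponent_nil {α : Type*} (x : ℕ → α) : UnboundedExponent [] x :=
  fun n => ⟨n, le_rfl, isFactor_wordPow_iff.2 ⟨0, fun u hu => by simp at hu⟩⟩

theorem exponentBound_pos {k M : ℕ} (hk : 2 ≤ k) : 0 < exponentBound k M :=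
  Nat.pow_pos (by omega)

theorem DigitRecursive.unboundedExponent {α : Type*} {k M : ℕ} {x : ℕ → α} (hk : 2 ≤ k)
    (hx : DigitRecursive k M x) {y : List α}
    (h : IsFactor (wordPow y (exponentBound k M)) x) : UnboundedExponent y x := by
  rcases y.length.eq_zero_or_pos with hy | hy
  · rw [List.length_eq_zero_iff.1 hy]
    exact unboundedExponent_nil x
  have hb := exponentBound_pos (M := M) hk
  obtain ⟨i, hi⟩ := isFactor_iff.1 (h.of_wordPow hb)
  obtain ⟨j, hj⟩ := (isFactor_wordPow_iff_powerAt hy hi hb).1 h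
  refine fun n => ⟨n + 1, by omega, ?_⟩
  obtain ⟨j', L, hL, hj'⟩ := hx.exists_powerAt_ge hk hy hj ((n + 1) * y.length)
  rw [isFactor_wordPow_iff_powerAt hy hi n.succ_pos]
  exact ⟨j', hj'.1, fun u hu => hj'.2 u (hu.trans_le hL)⟩

/-! ### The intrinsic threshold and its finite search -/

/-- Some word occurs in `x` with exponent `n`, but not with unbounded exponent. -/
def IsBoundedExponent {α : Type*} (x : ℕ → α) (n : ℕ) : Prop :=
  ∃ y, IsFactor (wordPow y n) x ∧ ¬ UnboundedExponent y x

/-- One more than the largest exponent of a word that does not occur with unbounded exponent. -/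
noncomputable def exponentThreshold {α : Type*} (x : ℕ → α) : ℕ :=
  sSup {n | IsBoundedExponent x n} + 1

section

variable {α : Type*} {k M : ℕ} {x : ℕ → α}

theorem DigitRecursive.lt_exponentBound (hk : 2 ≤ k) (hx : DigitRecursive k M x) {n : ℕ}
    (h : IsBoundedExponent x n) : n < exponentBound k M := by
  by_contra! hle
  obtain ⟨y, h1, h2⟩ := h
  exact h2 (hx.unboundedExponent hk (h1.wordPow_mono hle))

theorem DigitRecursive.unboundedExponent_of_threshold (hk : 2 ≤ k) (hx : DigitRecursive k M x)
    {y : List α} (h : IsFactor (wordPow y (exponentThreshold x)) x) : UnboundedExponent y x := by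
  by_contra hy
  have h1 : exponentThreshold x ≤ sSup {n | IsBoundedExponent x n} :=
    le_csSup ⟨exponentBound k M, fun n hn => (hx.lt_exponentBound hk hn).le⟩ ⟨y, h, hy⟩
  exact absurd h1 (Nat.not_succ_le_self _)

/-- A bounded search for a word that occurs in `x` with exponent `n`, but not with exponent `b`. -/
def SearchPower (x : ℕ → α) (W J b n : ℕ) : Prop :=
  ∃ i < W, ∃ p < W, (∃ j < J, ∀ u < n * p, x (j + u) = x (i + u % p)) ∧
    ¬ ∃ j < J, ∀ u < b * p, x (j + u) = x (i + u % p)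

theorem DigitRecursive.isBoundedExponent_iff (hk : 2 ≤ k) (hx : DigitRecursive k M x) {n : ℕ}
    (hn : 0 < n) (hnb : n ≤ exponentBound k M) :
    IsBoundedExponent x n ↔
      SearchPower x (k ^ wordDigits k M) (k ^ positionDigits k M) (exponentBound k M) n := by
  have hb := exponentBound_pos (M := M) hk
  constructor
  · rintro ⟨y, h1, h2⟩
    have hy : 0 < y.length := by
      refine List.length_pos_iff.2 ?_
      rintro rfl
      exact h2 (unboundedExponent_nil x)
    obtain ⟨i, hi⟩ := isFactor_iff.1 (h1.of_wordPow hn)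
    obtain ⟨i', hi', p, hp, h3, h4⟩ := hx.exists_small_word hk hnb
      ((isFactor_wordPow_iff_powerAt hy hi hn).1 h1) fun h =>
        h2 (hx.unboundedExponent hk ((isFactor_wordPow_iff_powerAt hy hi hb).2 h))
    -- For `p = 0` every power is empty and occurs, contrary to `h4`.
    have hp0 : 0 < p := by
      rcases p.eq_zero_or_pos with rfl | h
      · refine (h4 ⟨0, ?_, ?_⟩).elim
        · intro u hu
          omega
        · intro u hu
          omega
      · exact h
    refine ⟨i', hi', p, hp, ?_, ?_⟩
    · obtain ⟨j, hj, h5⟩ := hx.exists_small_position hk hnb hi' hp h3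
      exact ⟨j, hj, (powerAt_iff hp0 (Nat.le_mul_of_pos_left _ hn)).1 h5⟩
    · rintro ⟨j, -, h5⟩
      exact h4 ⟨j, (powerAt_iff hp0 (Nat.le_mul_of_pos_left _ hb)).2 h5⟩
  · rintro ⟨i, hi, p, hp, ⟨j, hj, h1⟩, h2⟩
    have hp0 : 0 < p := by
      rcases p.eq_zero_or_pos with rfl | h
      · exact (h2 ⟨j, hj, fun u hu => by omega⟩).elim
      · exact h
    let y : List α := List.ofFn fun u : Fin p => x (i + u)
    have hlen : y.length = p := List.length_ofFn
    have hy : ∀ u < y.length, y[u]? = some (x (i + u)) := fun u hu => by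
      rw [hlen] at hu
      simp [y, hu]
    have h1' := (powerAt_iff hp0 (Nat.le_mul_of_pos_left _ hn)).2 h1
    rw [← hlen] at hp0 h1'
    refine ⟨y, (isFactor_wordPow_iff_powerAt hp0 hy hn).2 ⟨j, h1'⟩, fun h => h2 ?_⟩
    obtain ⟨m, hm, h3⟩ := h (exponentBound k M)
    have h4 := (isFactor_wordPow_iff_powerAt hp0 hy hb).1 (h3.wordPow_mono hm)
    rw [hlen] at h4 hp0
    obtain ⟨j', hj', h5⟩ := hx.exists_small_position hk le_rfl hi hp h4
    exact ⟨j', hj', (powerAt_iff hp0 (Nat.le_mul_of_pos_left _ hb)).1 h5⟩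

theorem DigitRecursive.exponentThreshold_eq (hk : 2 ≤ k) (hx : DigitRecursive k M x)
    [DecidablePred (SearchPower x (k ^ wordDigits k M) (k ^ positionDigits k M)
      (exponentBound k M))] :
    exponentThreshold x = Nat.findGreatest
      (SearchPower x (k ^ wordDigits k M) (k ^ positionDigits k M) (exponentBound k M))
      (exponentBound k M) + 1 := by
  refine congrArg (· + 1) (le_antisymm (csSup_le' fun n hn => ?_) ?_)
  · have hlt := hx.lt_exponentBound hk hn
    -- The search characterizes only positive exponents. This is harmless: 0 does not affect the
    -- supremum, and it is also the value of `Nat.findGreatest` when nothing is found.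
    rcases n.eq_zero_or_pos with rfl | h
    · exact Nat.zero_le _
    · exact Nat.le_findGreatest hlt.le ((hx.isBoundedExponent_iff hk h hlt.le).1 hn)
  · by_cases h : Nat.findGreatest (SearchPower x (k ^ wordDigits k M) (k ^ positionDigits k M)
      (exponentBound k M)) (exponentBound k M) = 0
    · rw [h]
      exact Nat.zero_le _
    · refine le_csSup ⟨exponentBound k M, fun n hn => (hx.lt_exponentBound hk hn).le⟩ ?_
      exact (hx.isBoundedExponent_iff hk (Nat.pos_of_ne_zero h) (Nat.findGreatest_le _)).2
        (Nat.findGreatest_of_ne_zero rfl h)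

end

/-! ### From a DFAO to a digit recursion -/

theorem baseRep_mul_add {k : ℕ} (hk : 2 ≤ k) {n d : ℕ} (hd : d < k) (h : k * n + d ≠ 0) :
    baseRep k hk (k * n + d) = baseRep k hk n ++ [⟨d, hd⟩] := by
  have h1 : Nat.digits k (k * n + d) = d :: Nat.digits k n := by
    rw [Nat.digits_def' (by omega) (by omega), Nat.mul_add_mod, Nat.mod_eq_of_lt hd,
      Nat.mul_add_div (by omega), Nat.div_eq_of_lt hd, add_zero]
  simp [baseRep, h1]

/-- The DFAO need not fix its initial state on the digit 0. The additional state `none` represents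
the number 0 and absorbs leading zeros. -/
theorem DFAO.digitRecursive_seq {α : Type*} {k : ℕ} {σ : Type} [Fintype σ] (M : DFAO k σ α)
    (hk : 2 ≤ k) : DigitRecursive k (Fintype.card σ + 1) (M.seq hk) := by
  refine ⟨Option σ, inferInstance,
    fun n => if n = 0 then none else some ((baseRep k hk n).foldl M.step M.start),
    fun q d => if h : d < k then
      (if q = none ∧ d = 0 then none else some (M.step (q.getD M.start) ⟨d, h⟩)) else none,
    fun q => M.output (q.getD M.start), by simp, fun n d hd => ?_, fun n => ?_⟩
  · rcases n.eq_zero_or_pos with rfl | hn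
    · rcases d.eq_zero_or_pos with rfl | hd0
      · simp [hd]
      · dsimp only
        rw [if_neg (by omega), baseRep_mul_add hk hd (by omega)]
        simp [hd, hd0.ne', baseRep]
    · have h0 : 0 < k * n := Nat.mul_pos (by omega) hn
      dsimp only
      rw [if_neg (by omega), baseRep_mul_add hk hd (by omega)]
      simp [hd, hn.ne']
  · rcases n.eq_zero_or_pos with rfl | hn
    · simp [DFAO.seq, baseRep]
    · simp [DFAO.seq, hn.ne']

/-! ### Primitive recursiveness of the search -/

section

variable {α : Type*}

/-- The transition of the automaton with code `c`, as a function on numbers. -/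
def codeStep (c : ℕ × ℕ × List (α × List ℕ)) (q d : ℕ) : ℕ :=
  ((c.2.2[q]?.bind fun a => a.2[d]?).getD 0)

/-- The base of the automaton with code `c`, replaced by a number that is at least `2` if the
code is not valid. -/
def codeBase (c : ℕ × ℕ × List (α × List ℕ)) : ℕ := c.1 - 2 + 2

/-- The state of the automaton with code `c` after reading the representation of a number. -/
def codeState (c : ℕ × ℕ × List (α × List ℕ)) (n : ℕ) : ℕ :=
  if n = 0 then c.2.1 else codeStep c (codeState c (n / codeBase c)) (n % codeBase c)
termination_by n
decreasing_by exact Nat.div_lt_self (by omega) (by unfold codeBase; omega)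

/-- The letter of index `n` in the word generated by the automaton with code `c`. -/
def codeLetter (c : ℕ × ℕ × List (α × List ℕ)) (n : ℕ) : Option α :=
  c.2.2[codeState c n]?.map Prod.fst

theorem codeState_code {k m : ℕ} (hk : 2 ≤ k) (M : DFAO k (Fin m) α) (n : ℕ) :
    codeState M.code n = ((baseRep k hk n).foldl M.step M.start : Fin m) := by
  induction n using Nat.strong_induction_on with
  | _ n ih =>
  rw [codeState]
  split_ifs with hn
  · subst hn
    simp [baseRep, DFAO.code]
  · have hb : codeBase M.code = k := by simp only [codeBase, DFAO.code]; omega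
    have hd : n % k < k := Nat.mod_lt _ (by omega)
    have h1 : baseRep k hk n = baseRep k hk (n / k) ++ [⟨n % k, hd⟩] := by
      have h2 := Nat.div_add_mod n k
      have h3 := baseRep_mul_add hk (n := n / k) hd (by omega)
      rwa [h2] at h3
    rw [hb, ih _ (Nat.div_lt_self (by omega) (by omega)), h1, List.foldl_append]
    simp [codeStep, DFAO.code, hd]

theorem codeLetter_code {k m : ℕ} (hk : 2 ≤ k) (M : DFAO k (Fin m) α) (n : ℕ) :
    codeLetter M.code n = some (M.seq hk n) := by
  rw [codeLetter, codeState_code hk]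
  simp [DFAO.code, DFAO.seq]

variable [Primcodable α]

theorem Primrec.nat_pow : Primrec₂ ((· ^ ·) : ℕ → ℕ → ℕ) :=
  Primrec₂.unpaired'.1 Nat.Primrec.pow

theorem PrimrecRel.exists_lt_comp {β : Type*} [Primcodable β] {R : ℕ → β → Prop} {f : β → ℕ}
    (hR : PrimrecRel R) (hf : Primrec f) : PrimrecPred fun b => ∃ n < f b, R n b :=
  (hR.exists_mem_list.comp (Primrec.list_range.comp hf) .id).of_eq (by simp)

theorem PrimrecRel.forall_lt_comp {β : Type*} [Primcodable β] {R : ℕ → β → Prop} {f : β → ℕ}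
    (hR : PrimrecRel R) (hf : Primrec f) : PrimrecPred fun b => ∀ n < f b, R n b :=
  (hR.forall_mem_list.comp (Primrec.list_range.comp hf) .id).of_eq (by simp)

theorem primrec_codeBase : Primrec (codeBase (α := α)) :=
  Primrec.nat_add.comp (Primrec.nat_sub.comp .fst (.const 2)) (.const 2)

theorem primrec_codeStep :
    Primrec fun t : (ℕ × ℕ × List (α × List ℕ)) × ℕ × ℕ => codeStep t.1 t.2.1 t.2.2 := by
  refine Primrec.option_getD.comp (Primrec.option_bind ?_ ?_) (.const 0)
  · exact Primrec.list_getElem?.comp (Primrec.snd.comp (Primrec.snd.comp .fst))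
      (Primrec.fst.comp .snd)
  · exact Primrec.list_getElem?.comp (Primrec.snd.comp .snd)
      (Primrec.snd.comp (Primrec.snd.comp .fst))

theorem primrec_codeState : Primrec₂ (codeState (α := α)) := by
  -- Course-of-values recursion: `l` lists the states at all smaller numbers, so `l.length` is the
  -- current argument.
  let g : (ℕ × ℕ × List (α × List ℕ)) → List ℕ → Option ℕ := fun c l =>
    if l.length = 0 then some c.2.1
    else l[l.length / codeBase c]?.map fun q => codeStep c q (l.length % codeBase c)
  have hg : Primrec₂ g := by
    have hlen : Primrec fun t : (ℕ × ℕ × List (α × List ℕ)) × List ℕ => t.2.length :=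
      Primrec.list_length.comp .snd
    have hbase : Primrec fun t : (ℕ × ℕ × List (α × List ℕ)) × List ℕ => codeBase t.1 :=
      primrec_codeBase.comp .fst
    refine Primrec.ite (Primrec.eq.comp hlen (.const 0))
      (Primrec.option_some.comp (Primrec.fst.comp (Primrec.snd.comp .fst)))
      (Primrec.option_map
        (Primrec.list_getElem?.comp .snd (Primrec.nat_div.comp hlen hbase)) ?_)
    exact primrec_codeStep.comp (Primrec.pair (Primrec.fst.comp .fst)
      (Primrec.pair .snd ((Primrec.nat_mod.comp hlen hbase).comp .fst)))
  refine Primrec.nat_strong_rec _ hg fun c n => ?_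
  have hb : 2 ≤ codeBase c := by unfold codeBase; omega
  rw [codeState]
  simp only [g, List.length_map, List.length_range]
  split_ifs with hn
  · rfl
  · have hlt : n / codeBase c < n := Nat.div_lt_self (by omega) (by omega)
    simp [hlt]

theorem primrec_codeLetter : Primrec₂ (codeLetter (α := α)) :=
  Primrec.option_map (Primrec.list_getElem?.comp (Primrec.snd.comp (Primrec.snd.comp .fst))
    primrec_codeState) (Primrec.fst.comp .snd)

theorem primrecPred_power {β : Type*} [Primcodable β]
    {c : β → ℕ × ℕ × List (α × List ℕ)} {n i p J : β → ℕ} (hc : Primrec c) (hn : Primrec n)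
    (hi : Primrec i) (hp : Primrec p) (hJ : Primrec J) :
    PrimrecPred fun t => ∃ j < J t, ∀ u < n t * p t,
      codeLetter (c t) (j + u) = codeLetter (c t) (i t + u % p t) := by
  have h1 : PrimrecRel fun (u : ℕ) (s : ℕ × β) =>
      codeLetter (c s.2) (s.1 + u) = codeLetter (c s.2) (i s.2 + u % p s.2) := by
    have hβ : Primrec fun t : ℕ × ℕ × β => t.2.2 := Primrec.snd.comp .snd
    exact Primrec.eq.comp
      (primrec_codeLetter.comp (hc.comp hβ)
        (Primrec.nat_add.comp (Primrec.fst.comp .snd) .fst))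
      (primrec_codeLetter.comp (hc.comp hβ)
        (Primrec.nat_add.comp (hi.comp hβ) (Primrec.nat_mod.comp .fst (hp.comp hβ))))
  have h2 : PrimrecRel fun (j : ℕ) (t : β) => ∀ u < n t * p t,
      codeLetter (c t) (j + u) = codeLetter (c t) (i t + u % p t) :=
    h1.forall_lt_comp ((Primrec.nat_mul.comp hn hp).comp .snd)
  exact h2.exists_lt_comp hJ

theorem primrecRel_searchPower {W J b : ℕ × ℕ × List (α × List ℕ) → ℕ} (hW : Primrec W)
    (hJ : Primrec J) (hb : Primrec b) :
    PrimrecRel fun c n => SearchPower (codeLetter c) (W c) (J c) (b c) n := by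
  have h1 : PrimrecRel fun (p : ℕ) (s : ℕ × (ℕ × ℕ × List (α × List ℕ)) × ℕ) =>
      (∃ j < J s.2.1, ∀ u < s.2.2 * p,
        codeLetter s.2.1 (j + u) = codeLetter s.2.1 (s.1 + u % p)) ∧
      ¬ ∃ j < J s.2.1, ∀ u < b s.2.1 * p,
        codeLetter s.2.1 (j + u) = codeLetter s.2.1 (s.1 + u % p) := by
    have hc : Primrec fun t : ℕ × ℕ × (ℕ × ℕ × List (α × List ℕ)) × ℕ => t.2.2.1 :=
      Primrec.fst.comp (Primrec.snd.comp .snd)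
    have hi : Primrec fun t : ℕ × ℕ × (ℕ × ℕ × List (α × List ℕ)) × ℕ => t.2.1 :=
      Primrec.fst.comp .snd
    exact (primrecPred_power hc (Primrec.snd.comp (Primrec.snd.comp .snd)) hi .fst
      (hJ.comp hc)).and (primrecPred_power hc (hb.comp hc) hi .fst (hJ.comp hc)).not
  have h2 : PrimrecRel fun (i : ℕ) (t : (ℕ × ℕ × List (α × List ℕ)) × ℕ) => ∃ p < W t.1,
      (∃ j < J t.1, ∀ u < t.2 * p, codeLetter t.1 (j + u) = codeLetter t.1 (i + u % p)) ∧
      ¬ ∃ j < J t.1, ∀ u < b t.1 * p, codeLetter t.1 (j + u) = codeLetter t.1 (i + u % p) :=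
    h1.exists_lt_comp (hW.comp (Primrec.fst.comp .snd))
  exact h2.exists_lt_comp (hW.comp .fst)

section

variable {β : Type*} [Primcodable β] {k M : β → ℕ}

theorem Primrec.eqBound (hM : Primrec M) : Primrec fun t => eqBound (M t) :=
  Primrec.nat_mul.comp (Primrec.nat_pow.comp hM hM) (Primrec.nat_pow.comp hM hM)

theorem Primrec.agreeBound (hM : Primrec M) : Primrec fun t => agreeBound (M t) :=
  Primrec.nat_pow.comp (.const 2) (Primrec.nat_mul.comp (.const 8)
    (Primrec.nat_mul.comp hM.eqBound (.const 9)))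

theorem Primrec.powerBound (hM : Primrec M) : Primrec fun t => powerBound (M t) :=
  Primrec.nat_mul.comp (Primrec.nat_mul.comp hM.agreeBound (.const (2 ^ 3)))
    (Primrec.nat_mul.comp (Primrec.nat_pow.comp (.const 2) (Primrec.nat_mul.comp (.const 18)
      (Primrec.nat_mul.comp hM.eqBound (.const 16)))) (.const (2 ^ 3)))

theorem Primrec.firstBound (hM : Primrec M) : Primrec fun t => firstBound (M t) :=
  Primrec.nat_pow.comp (.const 2) (Primrec.nat_mul.comp (.const 8)
    (Primrec.nat_mul.comp hM.agreeBound (.const (2 ^ 3))))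

theorem Primrec.exponentBound (hk : Primrec k) (hM : Primrec M) :
    Primrec fun t => exponentBound (k t) (M t) :=
  Primrec.nat_pow.comp hk (Primrec.succ.comp (Primrec.nat_add.comp
    (Primrec.nat_pow.comp (.const 2) hM.powerBound) hM.firstBound))

theorem Primrec.wordDigits (hk : Primrec k) (hM : Primrec M) :
    Primrec fun t => wordDigits (k t) (M t) := by
  have h : Primrec fun t =>
      2 ^ _root_.powerBound (M t) * (_root_.exponentBound (k t) (M t) + 2) ^ 3 :=
    Primrec.nat_mul.comp (Primrec.nat_pow.comp (.const 2) hM.powerBound)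
      (Primrec.nat_pow.comp (Primrec.nat_add.comp (hk.exponentBound hM) (.const 2)) (.const 3))
  exact Primrec.nat_mul.comp h h

theorem Primrec.positionDigits (hk : Primrec k) (hM : Primrec M) :
    Primrec fun t => positionDigits (k t) (M t) :=
  Primrec.nat_add.comp (hk.wordDigits hM) (Primrec.nat_mul.comp hM.powerBound
    (Primrec.nat_pow.comp (Primrec.nat_add.comp (hk.exponentBound hM) (.const 2)) (.const 4)))

end

/-- The search only compares letters, so it may be run on the `Option`-valued `codeLetter`. -/
theorem searchPower_comp_iff {α α' : Type*} {f : α → α'} (hf : f.Injective) (x : ℕ → α)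
    (W J b n : ℕ) : SearchPower (fun i => f (x i)) W J b n ↔ SearchPower x W J b n := by
  simp only [SearchPower, hf.eq_iff]

theorem computableOnAutomatic_exponentThreshold :
    ComputableOnAutomatic (exponentThreshold (α := α)) := by
  classical
  -- The extra 1 counts the state added in `DFAO.digitRecursive_seq`.
  let m : ℕ × ℕ × List (α × List ℕ) → ℕ := fun c => c.2.2.length + 1
  have hk : Primrec fun c : ℕ × ℕ × List (α × List ℕ) => c.1 := .fst
  have hm : Primrec m := Primrec.succ.comp (Primrec.list_length.comp (Primrec.snd.comp .snd))
  have hW := Primrec.nat_pow.comp hk (hk.wordDigits hm)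
  have hJ := Primrec.nat_pow.comp hk (hk.positionDigits hm)
  have hb := hk.exponentBound hm
  refine ⟨_, (Primrec.succ.comp (Primrec.nat_findGreatest hb
    (primrecRel_searchPower hW hJ hb))).to_comp, fun k hk n M => ?_⟩
  have hx := M.digitRecursive_seq hk
  rw [Fintype.card_fin] at hx
  have hlen : m M.code = n + 1 := by simp [m, DFAO.code]
  have hletter : codeLetter M.code = fun i => some (M.seq hk i) :=
    funext (codeLetter_code hk M)
  rw [hx.exponentThreshold_eq hk, hletter, hlen]
  simp only [searchPower_comp_iff (Option.some_injective α)]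
  rfl

end

theorem theorem2 {α : Type*} [Primcodable α] :
    ∃ B : (ℕ → α) → ℕ, ComputableOnAutomatic B ∧
      ∀ (k : ℕ) (hk : 2 ≤ k) (x : ℕ → α), IsAutomatic k hk x →
        ∀ y : List α, IsFactor (wordPow y (B x)) x → UnboundedExponent y x := by
  refine ⟨exponentThreshold, computableOnAutomatic_exponentThreshold, ?_⟩
  rintro k hk x ⟨σ, hσ, M, rfl⟩ y hy
  have := Fintype.ofFinite σ
  exact (M.digitRecursive_seq hk).unboundedExponent_of_threshold hk hy
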